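/- Let $\delta\in(-1,0)$ and let $(p_x)_{x\ge 1}$ be numbers in $[0,1]$ with $$p_x=\frac12\Bigl(1-\frac{\delta}{2x}+o\Bigl(\frac1x\Bigr)\Bigr)\qquad (x\to\infty).$$ Let $(X_n)_{n\ge 0}$ be the Bessel-like walk with these parameters, that is, the Markov chain on $\mathbb N=\{0,1,2,\dots\}$ which is reflected at $0$ (from $0$ it moves to $1$ with probability $1$) and which from $x\ge 1$ moves to $x+1$ with probability $p_x$ and to $x-1$ with probability $1-p_x$. Write $\mathbb P_{x_0}$ for its law when $X_0=x_0$, and $\tau_A=\inf\{n\ge 0: X_n\le A\}$ (with $\inf\emptyset=\infty$). Then for all real $\alpha,\beta$ with $\alpha<1+\delta<\beta$ there exists $A>0$ such that for every integer $x_0>A$ there exist constants $C_\alpha,C_\beta>0$ such that for all integers $n\ge 1$, $$\frac{C_\beta}{n^{\beta/2}}\;\le\;\mathbb P_{x_0}(\tau_A>n)\;\le\;\frac{C_\alpha}{n^{\alpha/2}}.$$ -/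

import Mathlib

open MeasureTheory ProbabilityTheory Filter Asymptotics

/-- `p x` (for `x ≥ 1`) is the up-step probability at `x` of a Bessel-like walk with drift
parameter `δ`: it is a probability, and `p x = (1/2) (1 - δ / (2 x) + o(1 / x))` as `x → ∞`.
The value `p 0` plays no role, as the walk is reflected at `0`. -/
structure IsBesselLike (δ : ℝ) (p : ℕ → ℝ) : Prop where
  mem_Icc : ∀ x : ℕ, 1 ≤ x → p x ∈ Set.Icc (0 : ℝ) 1
  expansion : ∃ ε : ℕ → ℝ, (ε =o[atTop] fun x : ℕ => 1 / (x : ℝ)) ∧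
    ∀ x : ℕ, 1 ≤ x → p x = 1 / 2 * (1 - δ / (2 * (x : ℝ)) + ε x)

/-- One-step transition probabilities of the nearest-neighbour walk on `ℕ` reflected at `0`:
from `0` to `1` with probability `1`, and from `x ≥ 1` to `x + 1` with probability `p x` and to
`x - 1` with probability `1 - p x`. -/
noncomputable def stepProb (p : ℕ → ℝ) (x y : ℕ) : ℝ :=
  if x = 0 then (if y = 1 then 1 else 0)
  else if y = x + 1 then p x
  else if y + 1 = x then 1 - p x
  else 0

/-- The process `X` on the probability space `(Ω, P)` is a (time-homogeneous) Markov chain on `ℕ`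
started at `x₀` whose transition probabilities are `stepProb p`: for every `n` and all states
`s 0, …, s (n + 1)`,
`P (X 0 = s 0, …, X n = s n, X (n + 1) = s (n + 1))
  = P (X 0 = s 0, …, X n = s n) * stepProb p (s n) (s (n + 1))`. -/
structure IsNearestNeighbourWalk {Ω : Type*} [MeasurableSpace Ω] (P : Measure Ω)
    (p : ℕ → ℝ) (x₀ : ℕ) (X : ℕ → Ω → ℕ) : Prop where
  measurable : ∀ n, Measurable (X n)
  start : ∀ᵐ ω ∂P, X 0 ω = x₀
  markov : ∀ (n : ℕ) (s : ℕ → ℕ),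
    P.real {ω | ∀ k ≤ n + 1, X k ω = s k} =
      P.real {ω | ∀ k ≤ n, X k ω = s k} * stepProb p (s n) (s (n + 1))

/-- `τ_A = inf {n ≥ 0 : X n ≤ A}`, with value `⊤` (infinity) if there is no such `n`. -/
noncomputable def hitTime {Ω : Type*} (X : ℕ → Ω → ℕ) (A : ℝ) : Ω → WithTop ℕ :=
  hittingAfter X {x : ℕ | (x : ℝ) ≤ A} 0

/-! The Markov property identifies the tail of the hitting time with `survival`, so both bounds
become comparison arguments for a one-step recursion. A Taylor expansion shows that the generator
acts on `x ^ b` like `b / 2 * (b - (1 + δ)) * x ^ (b - 2)`, so `1 + δ` is the critical exponent.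

Upper bound (`survival_le_barrier`, `exists_survival_le`): for `a < 1 + δ` the power `x ^ a` loses a
fraction `ε / R ^ 2` per step while the walk stays below `R`. Surviving thus requires either
reaching `R`, at cost `R ^ (-a)`, or remaining in the window, at cost `(1 - ε / R ^ 2) ^ n`. A
window slightly smaller than `√n` makes the second cost negligible, at the price of an exponent
below `a`.

Lower bound (`le_survival_of_subsolution`, `exists_le_survival`): for `b > 1 + δ` the power `x ^ b`
is a subsolution, so a height `R` of order `√n` is reached before `A` with probability of order at
least `R ^ (-b)`. Since `δ < 0`, the drift far out is nonnegative, and from `R` the walk avoids `A`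
up to time `n` with probability at least `1 / 2` (`le_survival_of_half_le`). -/

/-- The probability that the nearest-neighbour walk with up-step probabilities `p`, started at `x`,
stays strictly above `A` up to time `n`, defined by recursion on the first step. -/
noncomputable def survival (p : ℕ → ℝ) (A : ℕ) : ℕ → ℕ → ℝ
  | 0, x => if A < x then 1 else 0
  | n + 1, x =>
    if A < x then p x * survival p A n (x + 1) + (1 - p x) * survival p A n (x - 1) else 0

lemma survival_of_le (p : ℕ → ℝ) {A x : ℕ} (n : ℕ) (h : x ≤ A) : survival p A n x = 0 := by
  cases n <;> simp [survival, not_lt.2 h]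

lemma survival_zero_of_lt (p : ℕ → ℝ) {A x : ℕ} (h : A < x) : survival p A 0 x = 1 := by
  simp [survival, h]

lemma survival_succ_of_lt (p : ℕ → ℝ) {A x : ℕ} (n : ℕ) (h : A < x) :
    survival p A (n + 1) x =
      p x * survival p A n (x + 1) + (1 - p x) * survival p A n (x - 1) := by
  simp [survival, h]

/-! ### Markov property and the law of the hitting time -/

namespace IsNearestNeighbourWalk

variable {Ω : Type*} [MeasurableSpace Ω] {P : Measure Ω} {p : ℕ → ℝ} {x₀ : ℕ} {X : ℕ → Ω → ℕ}

lemma measurableSet_path (h : IsNearestNeighbourWalk P p x₀ X) (m : ℕ) (s : ℕ → ℕ) :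
    MeasurableSet {ω | ∀ k ≤ m, X k ω = s k} := by
  have : {ω | ∀ k ≤ m, X k ω = s k} = ⋂ k, ⋂ (_ : k ≤ m), X k ⁻¹' {s k} := by
    ext; simp
  rw [this]
  exact MeasurableSet.iInter fun k => MeasurableSet.iInter fun _ =>
    h.measurable k (measurableSet_singleton _)

lemma measurableSet_above (h : IsNearestNeighbourWalk P p x₀ X) (A m n : ℕ) :
    MeasurableSet {ω | ∀ k ≤ n, A < X (m + k) ω} := by
  have : {ω | ∀ k ≤ n, A < X (m + k) ω} = ⋂ k, ⋂ (_ : k ≤ n), X (m + k) ⁻¹' Set.Ioi A := by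
    ext; simp
  rw [this]
  exact MeasurableSet.iInter fun k => MeasurableSet.iInter fun _ =>
    h.measurable _ measurableSet_Ioi

lemma measureReal_path_update (h : IsNearestNeighbourWalk P p x₀ X) (m : ℕ) (s : ℕ → ℕ) (y : ℕ) :
    P.real {ω | ∀ k ≤ m + 1, X k ω = Function.update s (m + 1) y k} =
      P.real {ω | ∀ k ≤ m, X k ω = s k} * stepProb p (s m) y := by
  have := h.markov m (Function.update s (m + 1) y)
  rw [this]
  have e : {ω | ∀ k ≤ m, X k ω = Function.update s (m + 1) y k} =
      {ω | ∀ k ≤ m, X k ω = s k} := by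
    ext ω
    refine forall₂_congr fun k hk => ?_
    rw [Function.update_of_ne (by omega)]
  rw [e, Function.update_self, Function.update_of_ne (by omega)]

lemma path_update_iff {S : Type*} (X : ℕ → S → ℕ) (m : ℕ) (s : ℕ → ℕ) (y : ℕ) (ω : S) :
    (∀ k ≤ m + 1, X k ω = Function.update s (m + 1) y k) ↔
      (∀ k ≤ m, X k ω = s k) ∧ X (m + 1) ω = y := by
  constructor
  · intro h
    refine ⟨fun k hk => ?_, ?_⟩
    · have := h k (by omega)
      rwa [Function.update_of_ne (by omega)] at this
    · simpa using h (m + 1) le_rfl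
  · rintro ⟨h, h'⟩ k hk
    rcases eq_or_lt_of_le hk with rfl | hk
    · simpa using h'
    · rw [Function.update_of_ne (by omega)]
      exact h k (by omega)

/-- The Markov property: given the path up to time `m`, the conditional probability of staying
above `A` for `n` more steps is `survival p A n` at the current position. -/
lemma measureReal_path_above [IsProbabilityMeasure P]
    (h : IsNearestNeighbourWalk P p x₀ X) (A n : ℕ) :
    ∀ (m : ℕ) (s : ℕ → ℕ),
      P.real ({ω | ∀ k ≤ m, X k ω = s k} ∩ {ω | ∀ k ≤ n, A < X (m + k) ω}) =
        P.real {ω | ∀ k ≤ m, X k ω = s k} * survival p A n (s m) := by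
  induction n with
  | zero =>
    intro m s
    by_cases hA : A < s m
    · rw [survival_zero_of_lt p hA, mul_one]
      congr 1
      ext ω
      simp only [Set.mem_inter_iff, Set.mem_ofPred_eq, Nat.le_zero, forall_eq, add_zero]
      exact ⟨fun h => h.1, fun h => ⟨h, by rw [h m le_rfl]; exact hA⟩⟩
    · rw [survival_of_le p _ (not_lt.1 hA), mul_zero]
      convert measureReal_empty (μ := P)
      ext ω
      simp only [Set.mem_inter_iff, Set.mem_ofPred_eq, Set.mem_empty_iff_false, iff_false]
      rintro ⟨h1, h2⟩
      have := h2 0 le_rfl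
      rw [add_zero, h1 m le_rfl] at this
      exact hA this
  | succ n ih =>
    intro m s
    by_cases hA : A < s m
    swap
    · rw [survival_of_le p _ (not_lt.1 hA), mul_zero]
      convert measureReal_empty (μ := P)
      ext ω
      simp only [Set.mem_inter_iff, Set.mem_ofPred_eq, Set.mem_empty_iff_false, iff_false]
      rintro ⟨h1, h2⟩
      have := h2 0 (Nat.zero_le _)
      rw [add_zero, h1 m le_rfl] at this
      exact hA this
    rw [survival_succ_of_lt p n hA]
    have hup := ih (m + 1) (Function.update s (m + 1) (s m + 1))
    have hdn := ih (m + 1) (Function.update s (m + 1) (s m - 1))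
    have hFup := h.measureReal_path_update m s (s m + 1)
    have hFdn := h.measureReal_path_update m s (s m - 1)
    have e1 : stepProb p (s m) (s m + 1) = p (s m) := by
      have : s m ≠ 0 := by omega
      simp [stepProb, this]
    have e2 : stepProb p (s m) (s m - 1) = 1 - p (s m) := by
      have h0 : s m ≠ 0 := by omega
      have h1 : s m - 1 ≠ s m + 1 := by omega
      have h2 : s m - 1 + 1 = s m := by omega
      simp [stepProb, h0, h1, h2]
    rw [e1] at hFup
    rw [e2] at hFdn
    rw [hFup, Function.update_self] at hup
    rw [hFdn, Function.update_self] at hdn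
    set F := {ω | ∀ k ≤ m, X k ω = s k}
    set Fu := {ω | ∀ k ≤ m + 1, X k ω = Function.update s (m + 1) (s m + 1) k}
    set Fd := {ω | ∀ k ≤ m + 1, X k ω = Function.update s (m + 1) (s m - 1) k}
    set G := {ω | ∀ k ≤ n, A < X (m + 1 + k) ω} with hG
    have mFu : MeasurableSet Fu := h.measurableSet_path _ _
    have mFd : MeasurableSet Fd := h.measurableSet_path _ _
    have mG : MeasurableSet G := h.measurableSet_above _ _ _
    have hdisj : Disjoint Fu Fd := by
      rw [Set.disjoint_left]
      intro ω h1 h2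
      have h1 := ((path_update_iff X m s _ ω).1 h1).2
      have h2 := ((path_update_iff X m s _ ω).1 h2).2
      omega
    have hsub : Fu ∪ Fd ⊆ F := by
      rintro ω (h1 | h1)
      · exact ((path_update_iff X m s _ ω).1 h1).1
      · exact ((path_update_iff X m s _ ω).1 h1).1
    -- The weights of the up- and down-steps add up to 1, so any other continuation of the path is
    -- null.
    have hnull : P.real (F \ (Fu ∪ Fd)) = 0 := by
      rw [measureReal_sdiff hsub (mFu.union mFd), measureReal_union hdisj mFd, hFup, hFdn]
      ring
    have hE : F ∩ {ω | ∀ k ≤ n + 1, A < X (m + k) ω} = F ∩ G := by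
      ext ω
      simp only [Set.mem_inter_iff, Set.mem_ofPred_eq, hG, and_congr_right_iff]
      intro hω
      constructor
      · intro h k hk
        have := h (k + 1) (by omega)
        rwa [show m + (k + 1) = m + 1 + k by ring] at this
      · intro h k hk
        rcases k with _ | k
        · rw [add_zero, hω m le_rfl]; exact hA
        · have := h k (by omega)
          rwa [show m + (k + 1) = m + 1 + k by ring]
    rw [hE]
    have hsplit : P.real (F ∩ G) = P.real ((Fu ∩ G) ∪ (Fd ∩ G)) := by
      apply le_antisymm
      · calc P.real (F ∩ G) ≤ P.real (((Fu ∩ G) ∪ (Fd ∩ G)) ∪ (F \ (Fu ∪ Fd))) := by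
              refine measureReal_mono (fun ω hω => ?_) (measure_ne_top _ _)
              by_cases h' : ω ∈ Fu ∪ Fd
              · left
                rw [← Set.union_inter_distrib_right]
                exact ⟨h', hω.2⟩
              · exact Or.inr ⟨hω.1, h'⟩
          _ ≤ _ := by
              refine (measureReal_union_le _ _).trans ?_
              rw [hnull, add_zero]
      · refine measureReal_mono ?_ (measure_ne_top _ _)
        rw [← Set.union_inter_distrib_right]
        exact Set.inter_subset_inter_left _ hsub
    rw [hsplit, measureReal_union
      (hdisj.mono Set.inter_subset_left Set.inter_subset_left) (mFd.inter mG), hup, hdn]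
    ring

lemma lt_hitTime_iff {S : Type*} [MeasurableSpace S] (X : ℕ → S → ℕ) (A n : ℕ) (ω : S) :
    (n : WithTop ℕ) < hitTime X A ω ↔ ∀ k ≤ n, A < X k ω := by
  constructor
  · intro hlt k hk
    have := notMem_of_lt_hittingAfter (u := X) (s := {x : ℕ | (x : ℝ) ≤ A}) (n := 0) (k := k)
      (ω := ω) (lt_of_le_of_lt (WithTop.coe_le_coe.2 hk) hlt) (Nat.zero_le _)
    simpa using this
  · intro hall
    unfold hitTime hittingAfter
    split_ifs with hex
    · have hmem := Nat.sInf_mem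
        (s := {i : ℕ | 0 ≤ i ∧ X i ω ∈ {x : ℕ | (x : ℝ) ≤ A}}) hex
      have h2 : X (sInf {i : ℕ | 0 ≤ i ∧ X i ω ∈ {x : ℕ | (x : ℝ) ≤ A}}) ω ≤ A := by
        exact_mod_cast hmem.2
      by_contra hcon
      have hle : sInf {i : ℕ | 0 ≤ i ∧ X i ω ∈ {x : ℕ | (x : ℝ) ≤ A}} ≤ n := by
        exact WithTop.coe_le_coe.1 (not_lt.1 hcon)
      exact absurd (hall _ hle) (not_lt.2 h2)
    · exact WithTop.coe_lt_top n

/-- The tail of the hitting time of `[0, A]` is the survival probability at the starting point. -/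
lemma measureReal_lt_hitTime [IsProbabilityMeasure P]
    (h : IsNearestNeighbourWalk P p x₀ X) (A n : ℕ) :
    P.real {ω | (n : WithTop ℕ) < hitTime X A ω} = survival p A n x₀ := by
  have hpath := h.measureReal_path_above A n 0 (fun _ => x₀)
  have hstart : P.real {ω | ∀ k ≤ 0, X k ω = x₀} = 1 := by
    have : {ω | ∀ k ≤ 0, X k ω = x₀} =ᵐ[P] Set.univ := by
      filter_upwards [h.start] with ω hω
      apply propext
      change (∀ k ≤ 0, X k ω = x₀) ↔ True
      simpa using hω
    rw [measureReal_congr this, probReal_univ]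
  rw [hstart, one_mul] at hpath
  rw [← hpath]
  apply measureReal_congr
  filter_upwards [h.start] with ω hω
  apply propext
  change (n : WithTop ℕ) < hitTime X A ω ↔ (∀ k ≤ 0, X k ω = x₀) ∧ ∀ k ≤ n, A < X (0 + k) ω
  rw [lt_hitTime_iff]
  simp [hω]

end IsNearestNeighbourWalk

/-! ### Asymptotics of the generator on powers -/

/-- The second order Taylor expansion of `t ↦ (1 + t) ^ b` at `0`, as a limit. -/
lemma tendsto_one_add_rpow_taylor_two (b : ℝ) :
    Tendsto (fun t : ℝ => ((1 + t) ^ b - 1 - b * t) / t ^ 2) (nhdsWithin 0 {0}ᶜ)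
      (nhds (b * (b - 1) / 2)) := by
  have hpos : ∀ᶠ t : ℝ in nhdsWithin 0 {0}ᶜ, 0 < 1 + t := by
    apply eventually_nhdsWithin_of_eventually_nhds
    have : Tendsto (fun t : ℝ => 1 + t) (nhds 0) (nhds (1 + 0)) := by
      exact (continuous_const.add continuous_id).tendsto 0
    exact this.eventually (lt_mem_nhds (by norm_num))
  have hder : ∀ c : ℝ, ∀ t : ℝ, 0 < 1 + t →
      HasDerivAt (fun t : ℝ => (1 + t) ^ c) (c * (1 + t) ^ (c - 1)) t := by
    intro c t ht
    have h1 : HasDerivAt (fun t : ℝ => 1 + t) 1 t := (hasDerivAt_id t).const_add 1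
    have := h1.rpow_const (p := c) (Or.inl ht.ne')
    simpa using this
  apply HasDerivAt.lhopital_zero_nhdsNE (f' := fun t => b * (1 + t) ^ (b - 1) - b)
    (g' := fun t => 2 * t)
  · filter_upwards [hpos] with t ht
    have := ((hder b t ht).sub_const 1).sub ((hasDerivAt_id t).const_mul b)
    rw [mul_one] at this
    exact this
  · filter_upwards with t
    simpa using hasDerivAt_pow 2 t
  · filter_upwards [self_mem_nhdsWithin] with t ht
    simpa using ht
  · apply tendsto_nhdsWithin_of_tendsto_nhds
    have h1 := (hder b 0 (by norm_num)).continuousAt.tendsto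
    have h2 := (h1.sub_const 1).sub ((continuous_const_mul b).tendsto 0)
    simpa using h2
  · apply tendsto_nhdsWithin_of_tendsto_nhds
    have := (continuous_pow (M := ℝ) 2).tendsto 0
    simpa using this
  -- After one differentiation the quotient is `b / 2` times the slope of `(1 + t) ^ (b - 1)` at 0,
  -- so a second l'Hôpital step is not needed.
  · have := (hasDerivAt_iff_tendsto_slope.1 (hder (b - 1) 0 (by norm_num))).const_mul (b / 2)
    have h3 : b / 2 * ((b - 1) * (1 + (0 : ℝ)) ^ (b - 1 - 1)) = b * (b - 1) / 2 := by
      rw [add_zero, Real.one_rpow]; ring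
    rw [h3] at this
    refine this.congr' ?_
    filter_upwards [self_mem_nhdsWithin] with t ht
    have ht : t ≠ 0 := ht
    simp only [slope_def_field, add_zero, Real.one_rpow, sub_zero]
    field_simp

namespace IsBesselLike

variable {δ : ℝ} {p : ℕ → ℝ}

lemma tendsto_drift (hp : IsBesselLike δ p) :
    Tendsto (fun x : ℕ => (x : ℝ) * (2 * p x - 1)) atTop (nhds (-δ / 2)) := by
  obtain ⟨ε, hε, hpe⟩ := hp.expansion
  have h1 : Tendsto (fun x : ℕ => ε x / (1 / (x : ℝ))) atTop (nhds 0) := hε.tendsto_div_nhds_zero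
  have h2 := h1.const_add (-δ / 2)
  rw [add_zero] at h2
  refine h2.congr' ?_
  filter_upwards [eventually_ge_atTop 1] with x hx
  have hx' : (x : ℝ) ≠ 0 := by positivity
  rw [hpe x hx]
  field_simp
  ring

/-- The generator of a Bessel-like walk applied to the power function `x ↦ x ^ b`, to leading
order. -/
lemma tendsto_generator_rpow (hp : IsBesselLike δ p) (b : ℝ) :
    Tendsto (fun x : ℕ => (x : ℝ) ^ 2 *
      (p x * (1 + (x : ℝ)⁻¹) ^ b + (1 - p x) * (1 - (x : ℝ)⁻¹) ^ b - 1)) atTop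
      (nhds (b / 2 * (b - (1 + δ)))) := by
  have hinv : Tendsto (fun x : ℕ => (x : ℝ)⁻¹) atTop (nhds 0) :=
    tendsto_inv_atTop_zero.comp tendsto_natCast_atTop_atTop
  have hne : ∀ᶠ x : ℕ in atTop, (x : ℝ)⁻¹ ∈ ({0}ᶜ : Set ℝ) := by
    filter_upwards [eventually_ge_atTop 1] with x hx
    have : (x : ℝ) ≠ 0 := by positivity
    simpa using this
  have hu := (tendsto_one_add_rpow_taylor_two b).comp
    (tendsto_nhdsWithin_of_tendsto_nhds_of_eventually_within _ hinv hne)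
  have hd := (tendsto_one_add_rpow_taylor_two b).comp
    (tendsto_nhdsWithin_of_tendsto_nhds_of_eventually_within (fun x : ℕ => -(x : ℝ)⁻¹)
      (by simpa using hinv.neg) (by filter_upwards [hne] with x hx; simpa using hx))
  have hdr := hp.tendsto_drift
  have hp2 : Tendsto p atTop (nhds (1 / 2)) := by
    have h := ((hdr.mul hinv).add_const 1).div_const 2
    have e : (-δ / 2 * 0 + 1) / 2 = (1 / 2 : ℝ) := by ring
    rw [e] at h
    refine h.congr' ?_
    filter_upwards [eventually_ge_atTop 1] with x hx
    have : (x : ℝ) ≠ 0 := by positivity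
    field_simp
    ring
  -- The two quadratic remainders contribute `b * (b - 1) / 2` in total; the linear terms leave `b`
  -- times the rescaled drift.
  have key := ((hp2.mul hu).add ((hp2.const_sub 1).mul hd)).add (hdr.const_mul b)
  have e : 1 / 2 * (b * (b - 1) / 2) + (1 - 1 / 2) * (b * (b - 1) / 2) + b * (-δ / 2) =
      b / 2 * (b - (1 + δ)) := by ring
  rw [e] at key
  refine key.congr' ?_
  filter_upwards [eventually_ge_atTop 1] with x hx
  have : (x : ℝ) ≠ 0 := by positivity
  simp only [Function.comp, ← sub_eq_add_neg]
  field_simp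
  ring

lemma generator_rpow_eq {x : ℕ} (hx : 1 ≤ x) (q b : ℝ) :
    q * ((x + 1 : ℕ) : ℝ) ^ b + (1 - q) * ((x - 1 : ℕ) : ℝ) ^ b =
      (x : ℝ) ^ b * (q * (1 + (x : ℝ)⁻¹) ^ b + (1 - q) * (1 - (x : ℝ)⁻¹) ^ b) := by
  have hx1 : (1 : ℝ) ≤ x := by exact_mod_cast hx
  have h0 : (0 : ℝ) < x := by linarith
  have h1 : ((x + 1 : ℕ) : ℝ) = x * (1 + (x : ℝ)⁻¹) := by
    push_cast; field_simp
  have h2 : ((x - 1 : ℕ) : ℝ) = x * (1 - (x : ℝ)⁻¹) := by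
    push_cast [hx]; field_simp
  have h3 : (x : ℝ)⁻¹ ≤ 1 := inv_le_one_of_one_le₀ hx1
  rw [h1, h2, Real.mul_rpow h0.le (by positivity), Real.mul_rpow h0.le (by linarith)]
  ring

/-- Below the critical exponent `1 + δ`, powers are strict supersolutions far from `0`. -/
lemma eventually_generator_rpow_le (hp : IsBesselLike δ p) {a : ℝ} (ha : 0 < a)
    (haδ : a < 1 + δ) :
    ∃ ε : ℝ, 0 < ε ∧ ε ≤ 1 ∧ ∀ᶠ x : ℕ in atTop,
      p x * ((x + 1 : ℕ) : ℝ) ^ a + (1 - p x) * ((x - 1 : ℕ) : ℝ) ^ a ≤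
        (x : ℝ) ^ a * (1 - ε / (x : ℝ) ^ 2) := by
  have hlim : a / 2 * (a - (1 + δ)) < 0 := mul_neg_of_pos_of_neg (by linarith) (by linarith)
  set L := a / 2 * (a - (1 + δ))
  -- Half of the limit is kept as margin; the cap at 1 later keeps `1 - ε / R ^ 2` nonnegative for
  -- `R ≥ 1`.
  refine ⟨min 1 (-L / 2), lt_min one_pos (by linarith), min_le_left _ _, ?_⟩
  filter_upwards [(hp.tendsto_generator_rpow a).eventually 
      (gt_mem_nhds (by linarith : L < L / 2)),
    eventually_ge_atTop 1] with x hx hx1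
  rw [generator_rpow_eq hx1]
  have h0 : (0 : ℝ) < x := by exact_mod_cast hx1
  gcongr
  have hm : min 1 (-L / 2) ≤ -L / 2 := min_le_right _ _
  rw [le_sub_iff_add_le, ← le_sub_iff_add_le', div_le_iff₀ (by positivity)]
  nlinarith

/-- Above the critical exponent `1 + δ`, powers are subsolutions far from `0`. -/
lemma eventually_le_generator_rpow (hp : IsBesselLike δ p) {b : ℝ} (hb : 0 < b)
    (hbδ : 1 + δ < b) :
    ∀ᶠ x : ℕ in atTop,
      (x : ℝ) ^ b ≤ p x * ((x + 1 : ℕ) : ℝ) ^ b + (1 - p x) * ((x - 1 : ℕ) : ℝ) ^ b := by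
  have hlim : 0 < b / 2 * (b - (1 + δ)) := mul_pos (by linarith) (by linarith)
  filter_upwards [(hp.tendsto_generator_rpow b).eventually (lt_mem_nhds hlim),
    eventually_ge_atTop 1] with x hx hx1
  rw [generator_rpow_eq hx1]
  have h0 : (0 : ℝ) < x := by exact_mod_cast hx1
  have h1 := pos_of_mul_pos_right hx (by positivity)
  exact le_mul_of_one_le_right (by positivity) (by linarith)

/-- The rescaled drift tends to `-δ / 2`, which is positive. This is where the sign of `δ` enters.
-/
lemma eventually_half_le (hp : IsBesselLike δ p) (hδ : δ < 0) :
    ∀ᶠ x : ℕ in atTop, 1 / 2 ≤ p x := by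
  filter_upwards [hp.tendsto_drift.eventually (lt_mem_nhds (a := 0) (by linarith)),
    eventually_ge_atTop 1] with x hx hx1
  have h1 := pos_of_mul_pos_right hx (by positivity)
  linarith

end IsBesselLike

/-! ### Comparison with barriers -/

section Barriers

variable {p : ℕ → ℝ} {A : ℕ}

/-- Upper barrier for the survival probability up to leaving a window of size `R`. -/
lemma survival_le_barrier (hp : ∀ x, A < x → p x ∈ Set.Icc (0 : ℝ) 1) {a ε R : ℝ} (ha : 0 < a)
    (hε : 0 < ε) (hε1 : ε ≤ 1) (hR : 1 ≤ R)
    (hsup : ∀ x : ℕ, A < x → p x * ((x + 1 : ℕ) : ℝ) ^ a + (1 - p x) * ((x - 1 : ℕ) : ℝ) ^ a ≤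
        (x : ℝ) ^ a * (1 - ε / (x : ℝ) ^ 2)) (n : ℕ) :
    ∀ x : ℕ, survival p A n x ≤ (x : ℝ) ^ a * ((R ^ a)⁻¹ + (1 - ε / R ^ 2) ^ n) := by
  have hR0 : 0 < R := by linarith
  have hr : 0 ≤ 1 - ε / R ^ 2 := by
    rw [sub_nonneg, div_le_one (by positivity)]
    nlinarith
  have hone : ∀ x : ℕ, A < x → (1 : ℝ) ≤ (x : ℝ) := fun x hx => by
    exact_mod_cast (by omega : 1 ≤ x)
  -- Outside the window the barrier exceeds 1, so the recursion is only needed for `x < R`.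
  have hfar : ∀ (n x : ℕ), R ≤ x → 1 ≤ (x : ℝ) ^ a * ((R ^ a)⁻¹ + (1 - ε / R ^ 2) ^ n) := by
    intro n x hx
    calc (1 : ℝ) = R ^ a * (R ^ a)⁻¹ := (mul_inv_cancel₀ (by positivity)).symm
      _ ≤ (x : ℝ) ^ a * ((R ^ a)⁻¹ + (1 - ε / R ^ 2) ^ n) := by
        have := pow_nonneg hr n
        gcongr
        linarith
  have hle1 : ∀ (n x : ℕ), survival p A n x ≤ 1 := by
    intro n
    induction n with
    | zero => intro x; rw [survival]; split_ifs <;> norm_num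
    | succ n ih =>
      intro x
      rw [survival]
      split_ifs with h
      · obtain ⟨h0, h1⟩ := hp x h
        nlinarith [ih (x + 1), ih (x - 1)]
      · norm_num
  induction n with
  | zero =>
    intro x
    by_cases hx : A < x
    · rw [survival_zero_of_lt p hx, pow_zero]
      have h1 : 1 ≤ (x : ℝ) ^ a := Real.one_le_rpow (hone x hx) ha.le
      have h2 : 0 ≤ (R ^ a)⁻¹ := by positivity
      nlinarith
    · rw [survival_of_le p _ (not_lt.1 hx)]
      positivity
  | succ n ih =>
    intro x
    by_cases hx : A < x
    swap
    · rw [survival_of_le p _ (not_lt.1 hx)]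
      have := pow_nonneg hr (n + 1)
      positivity
    by_cases hxR : R ≤ x
    · exact (hle1 _ _).trans (hfar _ _ hxR)
    rw [survival_succ_of_lt p n hx]
    obtain ⟨h0, h1⟩ := hp x hx
    set c := (R ^ a)⁻¹ + (1 - ε / R ^ 2) ^ n with hc
    have hc0 : 0 ≤ c := add_nonneg (by positivity) (pow_nonneg hr n)
    have hx1 := hone x hx
    have hεx : ε / R ^ 2 ≤ ε / (x : ℝ) ^ 2 := by
      have := (not_le.1 hxR).le
      gcongr
    calc p x * survival p A n (x + 1) + (1 - p x) * survival p A n (x - 1)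
        ≤ p x * (((x + 1 : ℕ) : ℝ) ^ a * c) + (1 - p x) * (((x - 1 : ℕ) : ℝ) ^ a * c) := by
          have : 0 ≤ 1 - p x := by linarith
          gcongr
          · exact ih (x + 1)
          · exact ih (x - 1)
      _ = (p x * ((x + 1 : ℕ) : ℝ) ^ a + (1 - p x) * ((x - 1 : ℕ) : ℝ) ^ a) * c := by ring
      _ ≤ ((x : ℝ) ^ a * (1 - ε / R ^ 2)) * c := by
          refine mul_le_mul_of_nonneg_right ((hsup x hx).trans ?_) hc0
          gcongr
      _ = (x : ℝ) ^ a * ((1 - ε / R ^ 2) * (R ^ a)⁻¹ + (1 - ε / R ^ 2) ^ (n + 1)) := by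
          rw [hc]; ring
      _ ≤ (x : ℝ) ^ a * ((R ^ a)⁻¹ + (1 - ε / R ^ 2) ^ (n + 1)) := by
          gcongr
          have h2 : 0 ≤ (R ^ a)⁻¹ := by positivity
          have h3 : 0 ≤ ε / R ^ 2 := by positivity
          nlinarith

/-- The squared positive part has second difference at most 2, so a symmetric step raises its mean
by at most 1; it is nondecreasing, so extra weight on `y - 1` only helps. -/
lemma posPart_sq_step {q y : ℝ} (hq : 1 / 2 ≤ q) :
    q * (max (y - 1) 0) ^ 2 + (1 - q) * (max (y + 1) 0) ^ 2 ≤ (max y 0) ^ 2 + 1 := by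
  rcases le_total y (-1) with h | h
  · rw [max_eq_right (by linarith), max_eq_right (by linarith), max_eq_right (by linarith)]
    norm_num
  rcases le_total y 0 with h' | h'
  · rw [max_eq_right (by linarith), max_eq_left (by linarith), max_eq_right h']
    nlinarith
  rcases le_total y 1 with h'' | h''
  · rw [max_eq_right (by linarith), max_eq_left (by linarith), max_eq_left h']
    nlinarith
  · rw [max_eq_left (by linarith), max_eq_left (by linarith), max_eq_left h']
    nlinarith

/-- A walk with nonnegative drift above `A` started at distance of order `M - A` from `A` needs a
time of order `(M - A) ^ 2` to reach `A`. -/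
lemma le_survival_of_half_le (hp : ∀ x, A < x → 1 / 2 ≤ p x ∧ p x ≤ 1) {M : ℝ} (hM : A < M)
    (n : ℕ) : ∀ x : ℕ,
      1 - ((max (M - x) 0) ^ 2 + n) / (M - A) ^ 2 ≤ survival p A n x := by
  have hMA : 0 < M - A := sub_pos.2 hM
  have hbelow : ∀ n x : ℕ, x ≤ A →
      1 - ((max (M - x) 0) ^ 2 + n) / (M - A) ^ 2 ≤ survival p A n x := by
    intro n x hx
    rw [survival_of_le p _ hx, sub_nonpos, one_le_div (by positivity)]
    have : (x : ℝ) ≤ A := by exact_mod_cast hx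
    have h1 : M - A ≤ max (M - x) 0 := le_max_of_le_left (by linarith)
    have h2 := pow_le_pow_left₀ hMA.le h1 2
    have : (0 : ℝ) ≤ n := by positivity
    linarith
  induction n with
  | zero =>
    intro x
    by_cases hx : A < x
    · rw [survival_zero_of_lt p hx]
      have : 0 ≤ ((max (M - x) 0) ^ 2 + ((0 : ℕ) : ℝ)) / (M - A) ^ 2 := by positivity
      linarith
    · exact hbelow _ _ (not_lt.1 hx)
  | succ n ih =>
    intro x
    by_cases hx : A < x
    swap
    · exact hbelow _ _ (not_lt.1 hx)
    rw [survival_succ_of_lt p n hx]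
    obtain ⟨h1, h2⟩ := hp x hx
    have hu := ih (x + 1)
    have hd := ih (x - 1)
    have hstep := posPart_sq_step (y := M - x) h1
    have e1 : M - ((x + 1 : ℕ) : ℝ) = M - x - 1 := by push_cast; ring
    have e2 : M - ((x - 1 : ℕ) : ℝ) = M - x + 1 := by
      rw [Nat.cast_sub (by omega)]; push_cast; ring
    rw [e1] at hu
    rw [e2] at hd
    have h3 : 0 ≤ 1 - p x := by linarith
    calc 1 - ((max (M - x) 0) ^ 2 + ((n + 1 : ℕ) : ℝ)) / (M - A) ^ 2
        ≤ 1 - (p x * (max (M - x - 1) 0) ^ 2 + (1 - p x) * (max (M - x + 1) 0) ^ 2 + n)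
            / (M - A) ^ 2 := by
          refine sub_le_sub_left (div_le_div_of_nonneg_right ?_ (by positivity)) 1
          push_cast
          linarith
      _ = p x * (1 - ((max (M - x - 1) 0) ^ 2 + n) / (M - A) ^ 2) +
            (1 - p x) * (1 - ((max (M - x + 1) 0) ^ 2 + n) / (M - A) ^ 2) := by ring
      _ ≤ _ := by gcongr

/-- Lower barrier for the survival probability: reach `R` before `A`, and then stay. -/
lemma le_survival_of_subsolution (hp : ∀ x, A < x → 1 / 2 ≤ p x ∧ p x ≤ 1) {b : ℝ} (hb : 0 < b)
    (hsub : ∀ x : ℕ, A < x →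
      (x : ℝ) ^ b ≤ p x * ((x + 1 : ℕ) : ℝ) ^ b + (1 - p x) * ((x - 1 : ℕ) : ℝ) ^ b)
    {n R : ℕ} (hAR : A < R) (hR : (2 * n : ℝ) ≤ ((R : ℝ) - A) ^ 2) :
    ∀ k ≤ n, ∀ x : ℕ, x ≤ R →
      ((x : ℝ) ^ b - (A : ℝ) ^ b) / (2 * (R : ℝ) ^ b) ≤ survival p A k x := by
  have hR0 : (0 : ℝ) < R := by exact_mod_cast (by omega : 0 < R)
  have hRA : (0 : ℝ) < (R : ℝ) - A := sub_pos.2 (by exact_mod_cast hAR)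
  have hhalf : ∀ x : ℕ, x ≤ R →
      ((x : ℝ) ^ b - (A : ℝ) ^ b) / (2 * (R : ℝ) ^ b) ≤ 1 / 2 := by
    intro x hx
    have h1 : (x : ℝ) ^ b ≤ (R : ℝ) ^ b := by gcongr
    have h2 : 0 ≤ (A : ℝ) ^ b := by positivity
    rw [div_le_iff₀ (by positivity)]
    linarith
  intro k
  induction k with
  | zero =>
    intro _ x hx
    by_cases hxA : A < x
    · rw [survival_zero_of_lt p hxA]
      linarith [hhalf x hx]
    · rw [survival_of_le p _ (not_lt.1 hxA)]
      refine div_nonpos_of_nonpos_of_nonneg (sub_nonpos.2 ?_) (by positivity)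
      have := not_lt.1 hxA
      gcongr
  | succ k ih =>
    intro hk x hx
    by_cases hxA : A < x
    swap
    · rw [survival_of_le p _ (not_lt.1 hxA)]
      refine div_nonpos_of_nonpos_of_nonneg (sub_nonpos.2 ?_) (by positivity)
      have := not_lt.1 hxA
      gcongr
    -- At `x = R` the barrier is at most `1 / 2`, and the nonnegative drift bound with `M = R` gives
    -- survival at least `1 / 2`. Below `R` both neighbours stay in the range of the induction.
    rcases eq_or_lt_of_le hx with rfl | hxR
    · refine (hhalf x le_rfl).trans (le_trans ?_ (le_survival_of_half_le hp
        (M := (x : ℝ)) (by exact_mod_cast hxA) (k + 1) x))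
      have h1 : ((k + 1 : ℕ) : ℝ) ≤ n := by exact_mod_cast hk
      have h2 : ((max ((x : ℝ) - x) 0) ^ 2 + ((k + 1 : ℕ) : ℝ)) / ((x : ℝ) - A) ^ 2 ≤ 1 / 2 := by
        rw [div_le_iff₀ (by positivity), sub_self, max_self]
        linarith
      linarith
    · rw [survival_succ_of_lt p k hxA]
      obtain ⟨h1, h2⟩ := hp x hxA
      have h3 : 0 ≤ 1 - p x := by linarith
      have h4 : 0 ≤ p x := by linarith
      have hu := ih (by omega) (x + 1) (by omega)
      have hd := ih (by omega) (x - 1) (by omega)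
      calc ((x : ℝ) ^ b - (A : ℝ) ^ b) / (2 * (R : ℝ) ^ b)
          ≤ (p x * ((x + 1 : ℕ) : ℝ) ^ b + (1 - p x) * ((x - 1 : ℕ) : ℝ) ^ b - (A : ℝ) ^ b) /
              (2 * (R : ℝ) ^ b) := by
            gcongr
            exact hsub x hxA
        _ = p x * ((((x + 1 : ℕ) : ℝ) ^ b - (A : ℝ) ^ b) / (2 * (R : ℝ) ^ b)) +
              (1 - p x) * ((((x - 1 : ℕ) : ℝ) ^ b - (A : ℝ) ^ b) / (2 * (R : ℝ) ^ b)) := by ring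
        _ ≤ _ := by gcongr

/-! ### Choice of the scale `R` -/

/-- Polynomial upper bound for the survival probability. -/
lemma exists_survival_le (hp : ∀ x, A < x → p x ∈ Set.Icc (0 : ℝ) 1) {α a ε : ℝ} (hα : 0 < α)
    (hαa : α < a) (hε : 0 < ε) (hε1 : ε ≤ 1)
    (hsup : ∀ x : ℕ, A < x → p x * ((x + 1 : ℕ) : ℝ) ^ a + (1 - p x) * ((x - 1 : ℕ) : ℝ) ^ a ≤
        (x : ℝ) ^ a * (1 - ε / (x : ℝ) ^ 2)) {x₀ : ℕ} (hx₀ : A < x₀) :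
    ∃ C : ℝ, 0 < C ∧ ∀ n : ℕ, 1 ≤ n → survival p A n x₀ ≤ C / (n : ℝ) ^ (α / 2) := by
  have ha : 0 < a := hα.trans hαa
  have hx0 : (0 : ℝ) < x₀ := by exact_mod_cast (by omega : 0 < x₀)
  set θ := 1 - α / a with hθ
  have hθ0 : 0 < θ := sub_pos.2 ((div_lt_one ha).2 hαa)
  -- Chosen so that `(n ^ θ) ^ s = n ^ (α / 2)`.
  set s := α / 2 / θ with hs
  have hs0 : 0 < s := by positivity
  refine ⟨(x₀ : ℝ) ^ a * (1 + (s / ε) ^ s), by positivity, fun n hn => ?_⟩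
  have hn1 : (1 : ℝ) ≤ n := by exact_mod_cast hn
  have hn0 : (0 : ℝ) < n := by linarith
  -- Makes `R ^ a = n ^ (α / 2)`, while `n / R ^ 2 = n ^ θ` still diverges.
  set R := (n : ℝ) ^ (α / 2 / a) with hRdef
  have hR : 1 ≤ R := Real.one_le_rpow hn1 (by positivity)
  have hRa : R ^ a = (n : ℝ) ^ (α / 2) := by
    rw [hRdef, ← Real.rpow_mul hn0.le, div_mul_cancel₀ _ ha.ne']
  have hR2 : ε / R ^ 2 * n = ε * (n : ℝ) ^ θ := by
    have h1 : R ^ 2 = (n : ℝ) ^ (α / a) := by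
      rw [hRdef, ← Real.rpow_natCast, ← Real.rpow_mul hn0.le]
      congr 1
      push_cast
      ring
    rw [h1, hθ, Real.rpow_sub hn0, Real.rpow_one]
    ring
  have hbase : 0 ≤ 1 - ε / R ^ 2 := by
    rw [sub_nonneg, div_le_one (by positivity)]
    nlinarith
  have hexp : (1 - ε / R ^ 2) ^ n ≤ (s / ε) ^ s / (n : ℝ) ^ (α / 2) := by
    have h1 : (1 - ε / R ^ 2) ^ n ≤ Real.exp (-(ε * (n : ℝ) ^ θ)) := by
      calc (1 - ε / R ^ 2) ^ n ≤ (Real.exp (-(ε / R ^ 2))) ^ n :=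
            pow_le_pow_left₀ hbase (Real.one_sub_le_exp_neg _) n
        _ = Real.exp (-(ε * (n : ℝ) ^ θ)) := by
            rw [← Real.exp_nat_mul, ← hR2]
            congr 1
            ring
    have h2 : (n : ℝ) ^ (α / 2) ≤ (s / ε) ^ s * Real.exp (ε * (n : ℝ) ^ θ) := by
      set y := (n : ℝ) ^ θ with hy
      have hy0 : 0 < y := by positivity
      have e1 : (n : ℝ) ^ (α / 2) = y ^ s := by
        rw [hy, ← Real.rpow_mul hn0.le, hs, mul_div_cancel₀ _ hθ0.ne']
      -- From `t ≤ exp t` at `t = ε * y / s`; raising it to the power `s` makes the exponential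
      -- exactly `exp (ε * y)`.
      have e2 : y ≤ s / ε * Real.exp (ε * y / s) := by
        have := Real.add_one_le_exp (ε * y / s)
        calc y = s / ε * (ε * y / s) := by field_simp
          _ ≤ _ := by gcongr; linarith
      calc (n : ℝ) ^ (α / 2) = y ^ s := e1
        _ ≤ (s / ε * Real.exp (ε * y / s)) ^ s := by gcongr
        _ = (s / ε) ^ s * Real.exp (ε * y) := by
            rw [Real.mul_rpow (by positivity) (Real.exp_pos _).le, ← Real.exp_mul,
              div_mul_cancel₀ _ hs0.ne']
    rw [le_div_iff₀ (by positivity)]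
    calc (1 - ε / R ^ 2) ^ n * (n : ℝ) ^ (α / 2)
        ≤ Real.exp (-(ε * (n : ℝ) ^ θ)) * ((s / ε) ^ s * Real.exp (ε * (n : ℝ) ^ θ)) := by
          gcongr
      _ = (s / ε) ^ s := by
          rw [mul_left_comm, ← Real.exp_add, neg_add_cancel, Real.exp_zero, mul_one]
  calc survival p A n x₀ ≤ (x₀ : ℝ) ^ a * ((R ^ a)⁻¹ + (1 - ε / R ^ 2) ^ n) :=
        survival_le_barrier hp ha hε hε1 hR hsup n x₀
    _ ≤ (x₀ : ℝ) ^ a * (((n : ℝ) ^ (α / 2))⁻¹ + (s / ε) ^ s / (n : ℝ) ^ (α / 2)) := by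
        rw [hRa]
        gcongr
    _ = _ := by ring

/-- Polynomial lower bound for the survival probability. -/
lemma exists_le_survival (hp : ∀ x, A < x → 1 / 2 ≤ p x ∧ p x ≤ 1) {b : ℝ} (hb : 0 < b)
    (hsub : ∀ x : ℕ, A < x →
      (x : ℝ) ^ b ≤ p x * ((x + 1 : ℕ) : ℝ) ^ b + (1 - p x) * ((x - 1 : ℕ) : ℝ) ^ b)
    {x₀ : ℕ} (hx₀ : A < x₀) :
    ∃ C : ℝ, 0 < C ∧ ∀ n : ℕ, 1 ≤ n → C / (n : ℝ) ^ (b / 2) ≤ survival p A n x₀ := by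
  have hpow : (0 : ℝ) < (x₀ : ℝ) ^ b - (A : ℝ) ^ b := by
    rw [sub_pos]
    have : (A : ℝ) < x₀ := by exact_mod_cast hx₀
    gcongr
  refine ⟨((x₀ : ℝ) ^ b - (A : ℝ) ^ b) / (2 * (x₀ + 3 : ℝ) ^ b), by positivity, fun n hn => ?_⟩
  have hn1 : (1 : ℝ) ≤ n := by exact_mod_cast hn
  have hn0 : (0 : ℝ) < n := by linarith
  have hsq1 : 1 ≤ √(n : ℝ) := Real.one_le_sqrt.2 hn1
  have hsq := Real.sq_sqrt hn0.le
  -- The factor 2 gives `(R - A) ^ 2 ≥ 4 * n`, more than the required `2 * n`; as `√n ≥ 1`, also `R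
  -- ≤ (x₀ + 3) * √n`.
  set R := x₀ + ⌈2 * √(n : ℝ)⌉₊ with hR
  have hRlow : (x₀ : ℝ) + 2 * √(n : ℝ) ≤ R := by
    rw [hR]; push_cast
    linarith [Nat.le_ceil (2 * √(n : ℝ))]
  have hRup : (R : ℝ) ≤ (x₀ + 3) * √(n : ℝ) := by
    rw [hR]; push_cast
    have := Nat.ceil_lt_add_one (a := 2 * √(n : ℝ)) (by positivity)
    have h0 : (0 : ℝ) ≤ x₀ := by positivity
    nlinarith
  have hAx : (A : ℝ) ≤ x₀ := by exact_mod_cast hx₀.le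
  have hR0 : (0 : ℝ) < R := by
    have h0 : (0 : ℝ) ≤ x₀ := by positivity
    linarith
  have hbar := le_survival_of_subsolution hp hb hsub (n := n) (R := R) (by omega)
    (by nlinarith) n le_rfl x₀ (by omega)
  refine le_trans ?_ hbar
  rw [div_div, mul_assoc]
  have e : (n : ℝ) ^ (b / 2) = √(n : ℝ) ^ b := by
    rw [Real.sqrt_eq_rpow, ← Real.rpow_mul hn0.le]
    congr 1
    ring
  rw [e, ← Real.mul_rpow (by positivity) (by positivity)]
  gcongr

end Barriers

/-! ### Conclusion -/

theorem mainTheorem5 (δ : ℝ) (hδ : δ ∈ Set.Ioo (-1 : ℝ) 0) (p : ℕ → ℝ)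
    (hp : IsBesselLike δ p) (α β : ℝ) (hα : α < 1 + δ) (hβ : 1 + δ < β) :
    ∃ A : ℝ, 0 < A ∧ ∀ x₀ : ℕ, A < (x₀ : ℝ) →
      ∃ Cα Cβ : ℝ, 0 < Cα ∧ 0 < Cβ ∧
        ∀ {Ω : Type*} [MeasurableSpace Ω] (P : Measure Ω) [IsProbabilityMeasure P]
          (X : ℕ → Ω → ℕ), IsNearestNeighbourWalk P p x₀ X →
          ∀ n : ℕ, 1 ≤ n →
            Cβ / (n : ℝ) ^ (β / 2) ≤ P.real {ω | (n : WithTop ℕ) < hitTime X A ω} ∧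
            P.real {ω | (n : WithTop ℕ) < hitTime X A ω} ≤ Cα / (n : ℝ) ^ (α / 2) := by
  obtain ⟨hδ1, hδ0⟩ := hδ
  -- `α` may be nonpositive, so it is first raised to a positive `α' < 1 + δ`; this only strengthens
  -- the bound, since `n ≥ 1`. The gap between `α'` and `a` pays for the window.
  obtain ⟨α', hα', hα'δ⟩ := exists_between (max_lt hα (by linarith : (0 : ℝ) < 1 + δ))
  obtain ⟨hαα', hα'0⟩ := max_lt_iff.1 hα'
  obtain ⟨a, hα'a, haδ⟩ := exists_between hα'δ
  have hβ0 : 0 < β := by linarith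
  obtain ⟨ε, hε, hε1, hsup⟩ := hp.eventually_generator_rpow_le (hα'0.trans hα'a) haδ
  obtain ⟨A, hA⟩ := eventually_atTop.1 (((hsup.and
    (hp.eventually_le_generator_rpow hβ0 hβ)).and (hp.eventually_half_le hδ0)).and
      (eventually_ge_atTop 1))
  have hA1 : 1 ≤ A := (hA A le_rfl).2
  have hmem : ∀ x, A < x → p x ∈ Set.Icc (0 : ℝ) 1 := fun x hx => hp.mem_Icc x (by omega)
  refine ⟨A, by exact_mod_cast hA1, fun x₀ hx₀ => ?_⟩
  have hx₀ : A < x₀ := by exact_mod_cast hx₀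
  obtain ⟨Cα, hCα, hup⟩ := exists_survival_le hmem hα'0 hα'a hε hε1
    (fun x hx => (hA x hx.le).1.1.1) hx₀
  obtain ⟨Cβ, hCβ, hlow⟩ := exists_le_survival
    (fun x hx => ⟨(hA x hx.le).1.2, (hmem x hx).2⟩) hβ0 (fun x hx => (hA x hx.le).1.1.2) hx₀
  refine ⟨Cα, Cβ, hCα, hCβ, ?_⟩
  intro Ω _ P _ X hX n hn
  rw [hX.measureReal_lt_hitTime A n]
  refine ⟨hlow n hn, (hup n hn).trans ?_⟩
  have hn1 : (1 : ℝ) ≤ n := by exact_mod_cast hn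
  gcongr
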